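/- Let $n\ge 1$ be an integer and let $p$ be an odd prime with $p\mid n$. For an inverse-closed subset $S$ of a finite abelian group $G$ (written additively) with $0\notin S$, the Cayley graph $\mathrm{Cay}(G,S)$ has vertex set $G$, with $g,h\in G$ adjacent if and only if $h-g\in S$. A finite connected graph with distance function $\partial$ and diameter $d$ is called distance-regular if, for all vertices $x,y$ with $\partial(x,y)=i$, the numbers of neighbours of $y$ at distance $i-1$, $i$ and $i+1$ from $x$ depend only on $i$ and not on the choice of $x,y$; it is called antipodal if the relation "$\partial(x,y)\in\{0,d\}$" is an equivalence relation on its vertex set. Then there is no antipodal bipartite distance-regular Cayley graph of diameter $4$ over $\mathbb{Z}_n\oplus\mathbb{Z}_p$; that is, for every inverse-closed subset $S\subseteq(\mathbb{Z}_n\oplus\mathbb{Z}_p)\setminus\{0\}$, the graph $\mathrm{Cay}(\mathbb{Z}_n\oplus\mathbb{Z}_p,S)$ is not simultaneously distance-regular, antipodal, bipartite and of diameter $4$. -/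

import Mathlib

namespace SimpleGraph

variable {V : Type*}

/-- A finite connected graph is distance-regular if, for vertices `x`, `y` at distance `i`, the
numbers `c_i(x, y)`, `a_i(x, y)`, `b_i(x, y)` of neighbours of `y` at distance `i - 1`, `i`, `i + 1`
from `x` depend only on `i` and not on the choice of `x` and `y`. (For `i = 0` the first number
is `0`.) -/
def IsDistanceRegular [Finite V] (Γ : SimpleGraph V) : Prop :=
  Γ.Connected ∧
    ∀ x y x' y' : V, Γ.dist x y = Γ.dist x' y' →
      {z | Γ.Adj y z ∧ Γ.dist x z + 1 = Γ.dist x y}.ncard =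
          {z | Γ.Adj y' z ∧ Γ.dist x' z + 1 = Γ.dist x' y'}.ncard ∧
      {z | Γ.Adj y z ∧ Γ.dist x z = Γ.dist x y}.ncard =
          {z | Γ.Adj y' z ∧ Γ.dist x' z = Γ.dist x' y'}.ncard ∧
      {z | Γ.Adj y z ∧ Γ.dist x z = Γ.dist x y + 1}.ncard =
          {z | Γ.Adj y' z ∧ Γ.dist x' z = Γ.dist x' y' + 1}.ncard

/-- A finite connected graph of diameter `d` is antipodal if being at distance `0` or `d` is an
equivalence relation on its vertices. -/
def IsAntipodal [Finite V] (Γ : SimpleGraph V) : Prop :=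
  Γ.Connected ∧ Equivalence fun x y : V => Γ.dist x y = 0 ∨ Γ.dist x y = Γ.diam

end SimpleGraph

/-!
Let `Γ` be an antipodal bipartite distance-regular Cayley graph of diameter `4` on an abelian group
`G`, with connection set `S` of size `k`. Let `φ : G → ℤ/2` be the parity of the distance from `0`
and let `N ⊆ ker φ` be the antipodal class of `0`. The intersection numbers say that `S` contains
exactly one element of each translate of `N` outside `ker φ`, and that in the group algebra
`S² = k + μ (ker φ - N)` (`SimpleGraph.exists_antipodalConnectionSet`). Counting gives `k = |N| μ`
and `|G| = 2 k |N|`. Three consequences carry the proof.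

* The map `s ↦ g - s` is an involution on the representations of `g` as a sum of two elements of
  `S`. So `μ` is even as soon as some `g ∈ ker φ` outside `N` is not of the form `2 s`
  (`AntipodalConnectionSet.even_of_forall_add_self_ne`).
* A translation by a nonzero element of `ker φ` cannot fix `S`, since then this element would have
  `k` representations (`AntipodalConnectionSet.not_forall_add_mem`).
* If `t` is an odd prime dividing neither `k` nor `|G|`, expanding `S ^ t` modulo `t` in two ways,
  by Frobenius and by the formula for `S²`, shows that multiplication by `t` either fixes `S` or
  exchanges `S` with its complement outside `ker φ`; in the second case `|N| = 2`
  (`AntipodalConnectionSet.multiplier`). By Dirichlet's theorem, this holds with any `u` coprime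
  to `|G|` in place of `t`.

For `G = ℤ/n × ℤ/p` the map `φ` is the parity of the first coordinate, and `n` is even. If
`n ≡ 2 mod 4`, then `k`, `|N|` and `μ` are odd, so every element of `ker φ` outside `N` is twice an
element of `S`, and there are too many of them. If `4 ∣ n`, multiplication by `1 + n / 2` is
translation by `(n / 2, 0)` outside `ker φ`. It cannot fix `S`, whence `|N| = 2` and `n p = 8 μ`.
The element `(0, 1)` has odd order `p`, so it is not in `N`, and it is not twice an element of
`S`; hence `μ` is even and `16 ∣ n`. Now `1 + n / 2 ≡ (1 + n / 4)² mod n`, and the square of a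
multiplication that fixes or exchanges `S` and its complement fixes `S`, a contradiction. The
`8`-cycle on `ℤ/8` shows that the factor of odd order is needed.
-/

/-! ### Connection sets and counting -/

/-- The arithmetic content of an antipodal bipartite distance-regular Cayley graph of diameter `4`
and valency `k`. The kernel of `φ` is the part of the bipartition containing `0`, the set `N` is the
antipodal class of `0`, and `S` is the connection set. The last two fields say that `S` is a
translate of a relative difference set: it meets every translate of `N` outside `ker φ` exactly
once, and an element of `ker φ` outside `N` has exactly `μ` representations as a sum of two elements
of `S`, whereas a nonzero element of `N` has none. -/
structure AntipodalConnectionSet {G : Type*} [AddCommGroup G] [DecidableEq G]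
    (φ : G →+ ZMod 2) (S N : Finset G) (k μ : ℕ) : Prop where
  card_eq : S.card = k
  two_le : 2 ≤ k
  two_le_card : 2 ≤ N.card
  neg_mem : ∀ s ∈ S, -s ∈ S
  parity : ∀ s ∈ S, φ s = 1
  zero_mem : 0 ∈ N
  neg_mem' : ∀ g ∈ N, -g ∈ N
  parity' : ∀ g ∈ N, φ g = 0
  existsUnique : ∀ g, φ g = 1 → ∃! s, s ∈ S ∧ g - s ∈ N
  card_filter : ∀ g, φ g = 0 →
    (S.filter fun s => g - s ∈ S).card = if g = 0 then k else if g ∈ N then 0 else μ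

namespace AntipodalConnectionSet

open Finset

variable {G : Type*} [AddCommGroup G] [DecidableEq G]
  {φ : G →+ ZMod 2} {S N : Finset G} {k μ : ℕ}

lemma zmod_two_cases (x : ZMod 2) : x = 0 ∨ x = 1 := by
  revert x; decide

lemma nonempty (h : AntipodalConnectionSet φ S N k μ) : S.Nonempty := by
  rw [← card_pos, h.card_eq]; have := h.two_le; omega

lemma card_odd_part [Fintype G] (h : AntipodalConnectionSet φ S N k μ) :
    (univ.filter fun g => φ g = 1).card = k * N.card := by
  rw [← h.card_eq, ← card_product]
  symm
  refine card_bij (fun x _ => x.1 + x.2) ?_ ?_ ?_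
  · rintro ⟨s, a⟩ hx
    simp only [mem_product] at hx
    simp [h.parity s hx.1, h.parity' a hx.2]
  · rintro ⟨s, a⟩ hx ⟨s', a'⟩ hx' e
    simp only [mem_product] at hx hx' e
    have hφ : φ (s + a) = 1 := by simp [h.parity s hx.1, h.parity' a hx.2]
    have hs : s = s' := (h.existsUnique _ hφ).unique ⟨hx.1, by simpa using hx.2⟩
      ⟨hx'.1, by simpa [e] using hx'.2⟩
    subst hs
    simpa using e
  · intro g hg
    obtain ⟨s, ⟨hs, hN⟩, -⟩ := h.existsUnique g (by simpa using hg)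
    exact ⟨(s, g - s), by simp [hs, hN], by simp⟩

lemma card_even_part [Fintype G] (h : AntipodalConnectionSet φ S N k μ) :
    (univ.filter fun g => φ g = 0).card = k * N.card := by
  obtain ⟨s, hs⟩ := h.nonempty
  have h1 := h.parity s hs
  rw [← h.card_odd_part]
  refine card_bij (fun x _ => x + s) ?_ ?_ ?_
  · intro x hx
    simp only [mem_filter, mem_univ, true_and] at hx
    simp [hx, h1]
  · intro x _ y _ e
    simpa using e
  · intro g hg
    simp only [mem_filter, mem_univ, true_and] at hg
    exact ⟨g - s, by simp [hg, h1], by simp⟩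

lemma card_group [Fintype G] (h : AntipodalConnectionSet φ S N k μ) :
    Fintype.card G = 2 * (k * N.card) := by
  have h1 := card_filter_add_card_filter_not (s := (univ : Finset G)) (fun g => φ g = 0)
  have h2 : (univ.filter fun g => ¬ φ g = 0) = univ.filter fun g => φ g = 1 := by
    ext g
    rcases zmod_two_cases (φ g) with e | e <;> simp [e]
  rw [h2, h.card_even_part, h.card_odd_part, card_univ] at h1
  omega

/-- Count the pairs of elements of `S` by their sum. -/
lemma valency_eq [Fintype G] (h : AntipodalConnectionSet φ S N k μ) : k = N.card * μ := by
  have h1 : (S ×ˢ S).card = ∑ g ∈ univ.filter (fun g => φ g = 0),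
      (S.filter fun s => g - s ∈ S).card := by
    rw [card_eq_sum_card_fiberwise (f := fun x => x.1 + x.2)
      (t := univ.filter fun g => φ g = 0)]
    · refine sum_congr rfl fun g _ => ?_
      refine card_bij (fun x _ => x.1) ?_ ?_ ?_
      · rintro ⟨s, s'⟩ hx
        simp only [mem_filter, mem_product] at hx
        obtain ⟨⟨a, b⟩, rfl⟩ := hx
        simp [a, b]
      · rintro ⟨s, s'⟩ hx ⟨t, t'⟩ hy e
        simp only [mem_filter, mem_product] at hx hy e
        subst e
        have := hx.2.trans hy.2.symm
        simpa using this
      · intro s hs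
        simp only [mem_filter] at hs
        exact ⟨(s, g - s), by simp [hs], rfl⟩
    · rintro ⟨s, s'⟩ hx
      simp only [coe_product, Set.mem_prod, mem_coe] at hx
      simp [h.parity s hx.1, h.parity s' hx.2]
      decide
  have h2 : ∀ g ∈ univ.filter (fun g => φ g = 0), (S.filter fun s => g - s ∈ S).card
      + (if g ∈ N then μ else 0) = (if g = 0 then k else 0) + μ := by
    intro g hg
    rw [h.card_filter g (by simpa using hg)]
    by_cases h0 : g = 0
    · simp [h0, h.zero_mem]
    · by_cases hN : g ∈ N <;> simp [h0, hN]
  have h3 := sum_congr rfl h2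
  rw [sum_add_distrib, sum_add_distrib, ← h1, card_product, h.card_eq, ← sum_filter, ← sum_filter,
    sum_const, sum_const, sum_const, h.card_even_part] at h3
  have e1 : (univ.filter fun g => φ g = 0).filter (· ∈ N) = N := by
    ext g
    simpa using h.parity' g
  have e2 : (univ.filter fun g => φ g = 0).filter (· = 0) = {0} := by
    ext g
    simp only [mem_filter, mem_univ, true_and, mem_singleton, and_iff_right_iff_imp]
    rintro rfl
    simp
  rw [e1, e2] at h3
  simp only [smul_eq_mul, card_singleton, one_mul] at h3
  have h4 := h.two_le
  -- the count reads `k * k + r * μ = k + k * r * μ`, that is, `(k - 1) * k = (k - 1) * r * μ`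
  obtain ⟨j, rfl⟩ : ∃ j, k = j + 1 := ⟨k - 1, by omega⟩
  have hj : 0 < j := by omega
  refine Nat.eq_of_mul_eq_mul_left hj ?_
  nlinarith

/-- The involution `s ↦ g - s` acts on the representations of `g` as a sum of two elements
of `S`. -/
lemma even_of_forall_add_self_ne (h : AntipodalConnectionSet φ S N k μ) {g : G} (hg : φ g = 0)
    (hgN : g ∉ N) (h2 : ∀ s ∈ S, s + s ≠ g) : Even μ := by
  have h0 : g ≠ 0 := fun e => hgN (e ▸ h.zero_mem)
  have hc := h.card_filter g hg
  rw [if_neg h0, if_neg hgN] at hc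
  have key : ∑ _s ∈ S.filter (fun s => g - s ∈ S), (1 : ZMod 2) = 0 := by
    refine sum_involution (fun s _ => g - s) (fun _ _ => by decide) ?_ ?_ ?_
    · intro s hs _ e
      simp only [mem_filter] at hs
      exact h2 s hs.1 (sub_eq_iff_eq_add.mp e).symm
    · intro s hs
      simp only [mem_filter] at hs ⊢
      simpa using hs.symm
    · intro s _
      simp
  rw [sum_const, hc, nsmul_one, ZMod.natCast_eq_zero_iff] at key
  exact even_iff_two_dvd.mpr key

/-- No nonzero translation in `ker φ` fixes `S`: its representation number would be `k`, which is
neither `0` nor `μ`. -/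
lemma not_forall_add_mem [Fintype G] (h : AntipodalConnectionSet φ S N k μ) {z : G} (hz : φ z = 0)
    (hz0 : z ≠ 0) : ¬ ∀ s ∈ S, s + z ∈ S := by
  intro hS
  have hc := h.card_filter z hz
  rw [filter_true_of_mem, h.card_eq, if_neg hz0] at hc
  · have h1 := h.valency_eq
    have h2 := h.two_le
    have h3 := h.two_le_card
    split_ifs at hc
    · omega
    · subst hc
      nlinarith
  · intro s hs
    have := hS (-s) (h.neg_mem s hs)
    rwa [neg_add_eq_sub] at this

/-! ### The multiplier theorem -/

/-- The sum of the elements of `A` in the group algebra over `ZMod t`. -/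
noncomputable def groupSum {X : Type*} (t : ℕ) (A : Finset X) : AddMonoidAlgebra (ZMod t) X :=
  ∑ a ∈ A, AddMonoidAlgebra.single a 1

lemma coeff_groupSum {X : Type*} [DecidableEq X] (t : ℕ) (A : Finset X) (g : X) :
    (groupSum t A).coeff g = if g ∈ A then 1 else 0 := by
  simp [groupSum, AddMonoidAlgebra.coeff_sum, Finsupp.single_apply]

lemma coeff_groupSum_mul (t : ℕ) (A B : Finset G) (g : G) :
    (groupSum t A * groupSum t B).coeff g = ((A.filter fun a => g - a ∈ B).card : ZMod t) := by
  rw [groupSum, sum_mul, AddMonoidAlgebra.coeff_sum, Finsupp.finsetSum_apply]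
  simp only [AddMonoidAlgebra.coeff_single_mul_apply, coeff_groupSum, one_mul, neg_add_eq_sub]
  rw [sum_boole]

/-- Modulo a prime `t`, the `t`-th power of `S` in the group algebra is the sum of the multiples
`t • s`. -/
lemma groupSum_pow_prime (t : ℕ) [Fact t.Prime] (A : Finset G)
    (hinj : Function.Injective fun g : G => t • g) (g : G) :
    (groupSum t A ^ t).coeff (t • g) = if g ∈ A then 1 else 0 := by
  have : CharP (AddMonoidAlgebra (ZMod t) G) t :=
    charP_of_injective_algebraMap (algebraMap (ZMod t) (AddMonoidAlgebra (ZMod t) G)).injective t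
  rw [groupSum, sum_pow_char]
  simp only [AddMonoidAlgebra.single_pow, one_pow, AddMonoidAlgebra.coeff_sum,
    Finsupp.finsetSum_apply, AddMonoidAlgebra.coeff_single, Finsupp.single_apply]
  simp only [hinj.eq_iff]
  simp

variable [Fintype G]

lemma groupSum_mul_odd_part (h : AntipodalConnectionSet φ S N k μ) (t : ℕ) :
    groupSum t S * groupSum t (univ.filter fun g => φ g = 1)
      = (k : ZMod t) • groupSum t (univ.filter fun g => φ g = 0) := by
  ext g
  rw [coeff_groupSum_mul, AddMonoidAlgebra.coeff_smul_apply, coeff_groupSum]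
  rcases zmod_two_cases (φ g) with e | e
  · rw [filter_true_of_mem, h.card_eq]
    · simp [e]
    · intro s hs
      simp [e, h.parity s hs]
  · rw [filter_false_of_mem]
    · simp [e]
    · intro s hs
      simp [e, h.parity s hs]

lemma groupSum_mul_even_part (h : AntipodalConnectionSet φ S N k μ) (t : ℕ) :
    groupSum t S * groupSum t (univ.filter fun g => φ g = 0)
      = (k : ZMod t) • groupSum t (univ.filter fun g => φ g = 1) := by
  ext g
  rw [coeff_groupSum_mul, AddMonoidAlgebra.coeff_smul_apply, coeff_groupSum]
  rcases zmod_two_cases (φ g) with e | e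
  · rw [filter_false_of_mem]
    · simp [e]
    · intro s hs
      simp [e, h.parity s hs]
  · rw [filter_true_of_mem, h.card_eq]
    · simp [e]
    · intro s hs
      simp [e, h.parity s hs]

lemma groupSum_mul_class (h : AntipodalConnectionSet φ S N k μ) (t : ℕ) :
    groupSum t S * groupSum t N = groupSum t (univ.filter fun g => φ g = 1) := by
  ext g
  rw [coeff_groupSum_mul, coeff_groupSum]
  rcases zmod_two_cases (φ g) with e | e
  · rw [filter_false_of_mem]
    · simp [e]
    · intro s hs hN
      have := h.parity' _ hN
      simp [e, h.parity s hs] at this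
  · obtain ⟨s, hs, hu⟩ := h.existsUnique g e
    have : (S.filter fun a => g - a ∈ N) = {s} := by
      ext a
      simp only [mem_filter, mem_singleton]
      exact ⟨fun ha => hu a ha, fun ha => ha ▸ hs⟩
    rw [this]
    simp [e]

lemma groupSum_sq (h : AntipodalConnectionSet φ S N k μ) (t : ℕ) :
    groupSum t S * groupSum t S + (μ : ZMod t) • groupSum t N
      = (k : ZMod t) • 1 + (μ : ZMod t) • groupSum t (univ.filter fun g => φ g = 0) := by
  ext g
  simp only [AddMonoidAlgebra.coeff_add, Finsupp.add_apply, AddMonoidAlgebra.coeff_smul_apply,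
    coeff_groupSum_mul, coeff_groupSum, AddMonoidAlgebra.one_def,
    AddMonoidAlgebra.coeff_single, Finsupp.single_apply]
  rcases zmod_two_cases (φ g) with e | e
  · rw [h.card_filter g e]
    by_cases h0 : g = 0
    · simp [h0, h.zero_mem]
    · by_cases hN : g ∈ N <;> simp [h0, hN, e, Ne.symm h0]
  · have h0 : g ≠ 0 := by rintro rfl; simp at e
    have hN : g ∉ N := fun hN => by simp [h.parity' g hN] at e
    rw [filter_false_of_mem]
    · simp [e, hN, Ne.symm h0]
    · intro s hs hs'
      have := h.parity _ hs'
      simp [e, h.parity s hs] at this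

/-- Odd powers of `S` in the group algebra are combinations of `S` and the complement of `ker φ`. -/
lemma exists_groupSum_pow (h : AntipodalConnectionSet φ S N k μ) (t j : ℕ) :
    ∃ c : ZMod t, groupSum t S ^ (2 * j + 1)
      = (k : ZMod t) ^ j • groupSum t S + c • groupSum t (univ.filter fun g => φ g = 1) := by
  induction j with
  | zero => exact ⟨0, by simp⟩
  | succ j ih =>
    obtain ⟨c, hc⟩ := ih
    have hsq := eq_sub_of_add_eq (h.groupSum_sq t)
    have hN := h.groupSum_mul_class t
    have hE := h.groupSum_mul_even_part t
    have hO := h.groupSum_mul_odd_part t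
    set X := groupSum t S
    set O := groupSum t (univ.filter fun g => φ g = 1)
    set E := groupSum t (univ.filter fun g => φ g = 0)
    have hcube : X * (X * X) = (k : ZMod t) • X + ((μ : ZMod t) * k - μ) • O := by
      rw [hsq, mul_sub, mul_add, mul_smul_comm, mul_smul_comm, mul_smul_comm, hN, hE, mul_one,
        smul_smul, sub_smul, add_sub_assoc]
    refine ⟨(k : ZMod t) ^ j * ((μ : ZMod t) * k - μ) + c * k * k, ?_⟩
    calc X ^ (2 * (j + 1) + 1) = X ^ (2 * j + 1) * (X * X) := by ring
      _ = (k : ZMod t) ^ j • (X * (X * X)) + c • (X * (X * O)) := by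
        rw [hc, add_mul, smul_mul_assoc, smul_mul_assoc]
        congr 2
        ring
      _ = _ := by
        rw [hcube, hO, mul_smul_comm, hE, smul_add, smul_smul, smul_smul, smul_smul, smul_smul,
          add_smul, pow_succ, add_assoc]

/-- Multiplication by an odd prime `t` not dividing `k`, if injective on `G`, either fixes `S` or
exchanges `S` with its complement outside `ker φ`. The sign is the quadratic character of `k`
modulo `t`. -/
theorem multiplier (h : AntipodalConnectionSet φ S N k μ) {t : ℕ} (ht : t.Prime) (ht2 : t ≠ 2)
    (htk : ¬ t ∣ k) (hinj : Function.Injective fun g : G => t • g) :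
    (∀ g, φ g = 1 → (t • g ∈ S ↔ g ∈ S)) ∨
      (N.card = 2 ∧ ∀ g, φ g = 1 → (t • g ∈ S ↔ g ∉ S)) := by
  have : Fact t.Prime := ⟨ht⟩
  have htodd : Odd t := ht.odd_of_ne_two ht2
  obtain ⟨j, hj⟩ := htodd
  have hφt : ∀ g, φ (t • g) = φ g := fun g => by
    rw [hj, map_nsmul, succ_nsmul, mul_nsmul, two_nsmul, CharTwo.add_self_eq_zero]
    simp
  have hbij := Finite.injective_iff_bijective.mp hinj
  obtain ⟨c, hc⟩ := h.exists_groupSum_pow t j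
  have key : ∀ g, φ g = 1 → (if g ∈ S then (1 : ZMod t) else 0)
      = (k : ZMod t) ^ j * (if t • g ∈ S then 1 else 0) + c := by
    intro g hg
    rw [← groupSum_pow_prime t S hinj g]
    conv_lhs => rw [show groupSum t S ^ t = groupSum t S ^ (2 * j + 1) by rw [← hj]]
    rw [hc, AddMonoidAlgebra.coeff_add, Finsupp.add_apply, AddMonoidAlgebra.coeff_smul_apply,
      AddMonoidAlgebra.coeff_smul_apply, coeff_groupSum, coeff_groupSum]
    simp [hφt, hg]
  have hk0 : (k : ZMod t) ≠ 0 := by rwa [Ne, ZMod.natCast_eq_zero_iff]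
  have hε : (k : ZMod t) ^ j = 1 ∨ (k : ZMod t) ^ j = -1 := by
    have := ZMod.pow_div_two_eq_neg_one_or_one t hk0
    rwa [show t / 2 = j by omega] at this
  have h3 : 2 < t := lt_of_le_of_ne ht.two_le (Ne.symm ht2)
  have h2ne : (2 : ZMod t) ≠ 0 := by
    have : ((2 : ℕ) : ZMod t) ≠ 0 := by
      rw [Ne, ZMod.natCast_eq_zero_iff]
      exact fun hd => absurd (Nat.le_of_dvd (by norm_num) hd) (by omega)
    exact_mod_cast this
  have h1ne : (1 : ZMod t) ≠ 0 := one_ne_zero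
  -- a point sent into `S` and a point of the same parity sent outside `S`
  obtain ⟨s, hs⟩ := h.nonempty
  obtain ⟨g₀, hg₀ : t • g₀ = s⟩ := hbij.2 s
  have hφg₀ : φ g₀ = 1 := by rw [← hφt, hg₀, h.parity s hs]
  obtain ⟨g₁, hφg₁, hg₁⟩ : ∃ g₁, φ g₁ = 1 ∧ t • g₁ ∉ S := by
    by_contra! hall
    have hsub : (univ.filter fun g => φ g = 1) ⊆ S := by
      intro g hg
      obtain ⟨g', rfl⟩ := hbij.2 g
      exact hall g' (by simpa [hφt] using hg)
    have := card_le_card hsub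
    rw [h.card_odd_part, h.card_eq] at this
    nlinarith [h.two_le, h.two_le_card]
  have k0 := key g₀ hφg₀
  have k1 := key g₁ hφg₁
  rw [hg₀, if_pos hs, mul_one] at k0
  rw [if_neg hg₁, mul_zero, zero_add] at k1
  rcases hε with hε | hε
  · left
    have hc0 : c = 0 := by
      rw [hε] at k0
      split_ifs at k0 k1
      · linear_combination -k0
      · exact k1.symm
      · exact absurd (by linear_combination k1 - k0) h2ne
      · exact k1.symm
    intro g hg
    have := key g hg
    rw [hε, hc0] at this
    by_cases a : g ∈ S <;> by_cases b : t • g ∈ S <;> simp [a, b] at this ⊢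
  · right
    have hc1 : c = 1 := by
      rw [hε] at k0
      split_ifs at k0 k1
      · exact k1.symm
      · exact absurd (by linear_combination k0 - k1) h2ne
      · exact k1.symm
      · exact absurd (by linear_combination k0 - k1) h1ne
    have hswap : ∀ g, φ g = 1 → (t • g ∈ S ↔ g ∉ S) := by
      intro g hg
      have := key g hg
      rw [hε, hc1] at this
      by_cases a : g ∈ S <;> by_cases b : t • g ∈ S <;> simp [a, b] at this ⊢
    refine ⟨?_, hswap⟩
    have hcard : (univ.filter fun g => φ g = 1 ∧ g ∉ S).card = S.card := by
      refine card_bij (fun g _ => t • g) ?_ ?_ ?_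
      · intro g hg
        simp only [mem_filter, mem_univ, true_and] at hg
        exact (hswap g hg.1).mpr hg.2
      · intro a _ b _ e
        exact hinj e
      · intro s hs
        obtain ⟨g, rfl⟩ := hbij.2 s
        have hφg : φ g = 1 := by rw [← hφt]; exact h.parity _ hs
        exact ⟨g, by simp [hφg, (hswap g hφg).mp hs], rfl⟩
    have hsplit := card_filter_add_card_filter_not (s := univ.filter fun g => φ g = 1) (· ∈ S)
    rw [filter_filter, filter_filter, hcard, h.card_odd_part] at hsplit
    have hSS : (univ.filter fun g => φ g = 1 ∧ g ∈ S) = S := by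
      ext g
      simpa using h.parity g
    rw [hSS, h.card_eq] at hsplit
    have h2 := h.two_le
    refine Nat.eq_of_mul_eq_mul_left (show 0 < k by omega) ?_
    omega

end AntipodalConnectionSet

/-! ### Distances in Cayley graphs -/

namespace SimpleGraph

lemma Connected.exists_adj_dist_eq {V : Type*} {Γ : SimpleGraph V} (hΓ : Γ.Connected) {x y : V}
    {n : ℕ} (h : Γ.dist x y = n + 1) : ∃ z, Γ.Adj z y ∧ Γ.dist x z = n := by
  obtain ⟨p, hp⟩ := hΓ.exists_walk_length_eq_dist y x
  rw [dist_comm, h] at hp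
  cases p with
  | nil => simp at hp
  | @cons _ z _ hz q =>
    refine ⟨z, hz.symm, ?_⟩
    have h1 : Γ.dist z x ≤ n := (dist_le q).trans (by simpa using hp.le)
    have h2 := hΓ.dist_triangle (u := x) (v := z) (w := y)
    rw [h, dist_eq_one_iff_adj.mpr hz.symm] at h2
    rw [dist_comm] at h1
    omega

lemma IsBipartite.natCast_dist_add {V : Type*} {Γ : SimpleGraph V} (hΓ : Γ.Connected)
    (hb : Γ.IsBipartite) (x y z : V) :
    (Γ.dist x z : ZMod 2) = Γ.dist x y + Γ.dist y z := by
  obtain ⟨c⟩ := hb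
  have c' : Γ.Coloring Bool := recolorOfEquiv Γ finTwoEquiv c
  have key : ∀ u v, Even (Γ.dist u v) ↔ (c' u ↔ c' v) := fun u v => by
    obtain ⟨p, hp⟩ := hΓ.exists_walk_length_eq_dist u v
    rw [← hp]
    exact c'.even_length_iff_congr p
  rw [← Nat.cast_add, ← sub_eq_zero, CharTwo.sub_eq_add, ← Nat.cast_add,
    ZMod.natCast_eq_zero_iff_even, Nat.even_add, Nat.even_add, key, key, key]
  tauto

variable {G : Type*} [AddCommGroup G] {S : Set G}

lemma addCayley_adj_iff (hS0 : 0 ∉ S) (hSneg : ∀ s ∈ S, -s ∈ S) (x y : G) :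
    (addCayley S).Adj x y ↔ y - x ∈ S := by
  rw [addCayley_adj]
  constructor
  · rintro ⟨-, h | h⟩
    · rwa [neg_add_eq_sub] at h
    · simpa [neg_add_eq_sub] using hSneg _ h
  · intro h
    refine ⟨?_, Or.inl (by rwa [neg_add_eq_sub])⟩
    rintro rfl
    simp [hS0] at h

lemma addCayley_dist_add_left_le (hc : (addCayley S).Connected) (g x y : G) :
    (addCayley S).dist (g + x) (g + y) ≤ (addCayley S).dist x y := by
  obtain ⟨p, hp⟩ := hc.exists_walk_length_eq_dist x y
  let f : addCayley S →g addCayley S := ⟨fun x => g + x, fun h => by simpa using h⟩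
  rw [← hp, ← Walk.length_map f p]
  exact dist_le (p.map f)

lemma addCayley_dist_eq (hc : (addCayley S).Connected) (x y : G) :
    (addCayley S).dist x y = (addCayley S).dist 0 (y - x) := by
  apply le_antisymm
  · simpa using addCayley_dist_add_left_le hc x 0 (y - x)
  · simpa [neg_add_eq_sub] using addCayley_dist_add_left_le hc (-x) x y

/-- The bipartition of `addCayley S` as a homomorphism: the parity of the distance from `0`. -/
noncomputable def addCayleyParity (hc : (addCayley S).Connected)
    (hb : (addCayley S).IsBipartite) : G →+ ZMod 2 where
  toFun g := (addCayley S).dist 0 g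
  map_zero' := by simp
  map_add' x y := by
    rw [hb.natCast_dist_add hc 0 x (x + y), addCayley_dist_eq hc x (x + y), add_sub_cancel_left]

/-- In an antipodal bipartite distance-regular Cayley graph of diameter `4` the intersection numbers
`c₂ = μ` and `b₃ ≠ 0` give the two relations between `S` and the antipodal class of `0`. -/
theorem exists_antipodalConnectionSet [Fintype G] [DecidableEq G] (hS0 : (0 : G) ∉ S)
    (hSneg : ∀ s ∈ S, -s ∈ S) (hdr : (addCayley S).IsDistanceRegular)
    (hant : (addCayley S).IsAntipodal) (hb : (addCayley S).IsBipartite)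
    (hd : (addCayley S).diam = 4) :
    ∃ (φ : G →+ ZMod 2) (S' N : Finset G) (k μ : ℕ), AntipodalConnectionSet φ S' N k μ := by
  classical
  obtain ⟨hc, hreg⟩ := hdr
  obtain ⟨-, hequiv⟩ := hant
  rw [hd] at hequiv
  have hadj := addCayley_adj_iff hS0 hSneg
  have hdist := addCayley_dist_eq hc
  have hle : ∀ x y, (addCayley S).dist x y ≤ 4 := fun x y =>
    hd ▸ dist_le_diam (ediam_ne_top_of_diam_ne_zero (by omega))
  have hmem : ∀ g, (addCayley S).dist 0 g = 1 ↔ g ∈ S := fun g => by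
    rw [dist_eq_one_iff_adj, hadj, sub_zero]
  obtain ⟨x₄, h4⟩ : ∃ x, (addCayley S).dist 0 x = 4 := by
    obtain ⟨u, v, huv⟩ := (addCayley S).exists_dist_eq_diam
    exact ⟨v - u, by rw [← hdist, huv, hd]⟩
  obtain ⟨x₃, h34, h3⟩ := hc.exists_adj_dist_eq (n := 3) h4
  obtain ⟨x₂, -, h2⟩ := hc.exists_adj_dist_eq (n := 2) h3
  obtain ⟨x₁, h12, h1⟩ := hc.exists_adj_dist_eq (n := 1) h2
  have hset : ∀ g, (addCayley S).dist 0 g = 2 →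
      {z | (addCayley S).Adj g z ∧ (addCayley S).dist 0 z + 1 = (addCayley S).dist 0 g}
        = ((S.toFinset.filter fun s => g - s ∈ S.toFinset : Finset G) : Set G) := by
    intro g hg
    ext z
    have : (addCayley S).dist 0 z + 1 = 2 ↔ (addCayley S).dist 0 z = 1 := by omega
    simp only [hg, Set.mem_ofPred_eq, Finset.coe_filter, Set.mem_toFinset, this, hmem]
    rw [adj_comm, hadj, and_comm]
  have hdist2 : ∀ s ∈ S, ∀ s' ∈ S, (addCayley S).dist s s' ≤ 2 := by
    intro s hs s' hs'
    have := hc.dist_triangle (u := s) (v := 0) (w := s')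
    rw [dist_comm (u := s) (v := 0), (hmem s).mpr hs, (hmem s').mpr hs'] at this
    exact this
  have hparity : ∀ g, addCayleyParity hc hb g = ((addCayley S).dist 0 g : ZMod 2) := fun _ => rfl
  refine ⟨addCayleyParity hc hb, S.toFinset,
    Finset.univ.filter fun g => (addCayley S).dist 0 g = 0 ∨ (addCayley S).dist 0 g = 4,
    S.toFinset.card, (S.toFinset.filter fun s => x₂ - s ∈ S.toFinset).card,
    { card_eq := rfl, two_le := ?_, two_le_card := ?_, neg_mem := ?_, parity := ?_, zero_mem := ?_,
      neg_mem' := ?_, parity' := ?_, existsUnique := ?_, card_filter := ?_ }⟩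
  · -- `S` contains the distinct elements `-x₁` and `x₂ - x₁`
    have m1 : x₁ ∈ S := (hmem _).mp h1
    have m2 : x₂ - x₁ ∈ S := (hadj _ _).mp h12
    refine Finset.one_lt_card.mpr ⟨-x₁, by simpa using hSneg _ m1, x₂ - x₁, by simpa using m2, ?_⟩
    intro e
    have : x₂ = 0 := by simpa [sub_eq_add_neg] using e.symm
    simp [this] at h2
  · refine Finset.one_lt_card.mpr ⟨0, by simp, x₄, by simp [h4], ?_⟩
    rintro rfl
    simp at h4
  · simpa using hSneg
  · intro s hs
    rw [hparity, (hmem s).mpr (by simpa using hs)]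
    simp
  · simp
  · intro g hg
    have : (addCayley S).dist 0 (-g) = (addCayley S).dist 0 g := by
      rw [dist_comm, hdist, zero_sub, neg_neg]
    simpa only [Finset.mem_filter, Finset.mem_univ, true_and, this] using hg
  · intro g hg
    rw [hparity]
    rcases (Finset.mem_filter.mp hg).2 with e | e <;> rw [e]
    · simp
    · decide
  · intro g hg
    obtain ⟨s, hs, hsN⟩ : ∃ s ∈ S, (addCayley S).dist 0 (g - s) = 0 ∨
        (addCayley S).dist 0 (g - s) = 4 := by
      have hg4 := hle 0 g
      rw [hparity] at hg
      obtain h | h : (addCayley S).dist 0 g = 1 ∨ (addCayley S).dist 0 g = 3 := by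
        rw [ZMod.natCast_eq_one_iff_odd] at hg
        obtain ⟨m, hm⟩ := hg
        omega
      · exact ⟨g, (hmem g).mp h, by simp⟩
      · have hb3 := (hreg 0 g 0 x₃ (h.trans h3.symm)).2.2
        have hne : {z | (addCayley S).Adj x₃ z ∧
            (addCayley S).dist 0 z = (addCayley S).dist 0 x₃ + 1}.ncard ≠ 0 :=
          Set.ncard_ne_zero_of_mem (a := x₄) ⟨h34, by rw [h4, h3]⟩
        rw [← hb3] at hne
        obtain ⟨z, hz, hz4⟩ := Set.nonempty_of_ncard_ne_zero hne
        refine ⟨g - z, (hadj _ _).mp hz.symm, Or.inr ?_⟩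
        rw [sub_sub_cancel, hz4, h]
    refine ⟨s, ⟨by simpa using hs, Finset.mem_filter.mpr ⟨Finset.mem_univ _, hsN⟩⟩, ?_⟩
    rintro s' ⟨hs', hsN'⟩
    simp only [Finset.mem_filter, Finset.mem_univ, true_and, Set.mem_toFinset] at hs' hsN'
    rw [← hdist] at hsN hsN'
    have htr := hequiv.trans hsN' (hequiv.symm hsN)
    have := hdist2 s' hs' s hs
    exact hc.dist_eq_zero_iff.mp (by omega)
  · intro g hg
    rw [hparity, ZMod.natCast_eq_zero_iff_even] at hg
    have hg4 := hle 0 g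
    by_cases h0 : g = 0
    · subst h0
      rw [if_pos rfl, Finset.filter_true_of_mem]
      simpa using hSneg
    have hd0 : (addCayley S).dist 0 g ≠ 0 := fun e => h0 (hc.dist_eq_zero_iff.mp e).symm
    rw [if_neg h0]
    obtain h | h : (addCayley S).dist 0 g = 2 ∨ (addCayley S).dist 0 g = 4 := by
      obtain ⟨m, hm⟩ := hg
      omega
    · rw [if_neg (by rw [Finset.mem_filter, h]; simp)]
      have := (hreg 0 g 0 x₂ (h.trans h2.symm)).1
      rwa [hset g h, hset x₂ h2, Set.ncard_coe_finset, Set.ncard_coe_finset] at this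
    · rw [if_pos (by simp [h]), Finset.card_eq_zero]
      refine Finset.filter_false_of_mem fun s hs hgs => ?_
      simp only [Set.mem_toFinset] at hs hgs
      have h5 := hdist2 (-s) (hSneg s hs) (g - s) hgs
      rw [hdist] at h5
      simp only [sub_neg_eq_add, sub_add_cancel] at h5
      omega

end SimpleGraph

/-! ### The group `ℤ/n × ℤ/p` -/

namespace AntipodalConnectionSet

open Finset

variable {n p : ℕ} {φ : ZMod n × ZMod p →+ ZMod 2}
  {S N : Finset (ZMod n × ZMod p)} {k μ : ℕ}

/-- As `p` is odd, the parity only depends on the first coordinate. -/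
lemma parity_eq (hp : Odd p) (x : ℕ) (y : ZMod p) : φ ((x : ZMod n), y) = x * φ (1, 0) := by
  have h1 : φ (0, y) = 0 := by
    have e : φ (p • ((0 : ZMod n), y)) = 0 := by simp [← Prod.zero_eq_mk]
    rw [map_nsmul, nsmul_eq_mul, (ZMod.natCast_eq_one_iff_odd).mpr hp, one_mul] at e
    exact e
  have h2 : ((x : ZMod n), y) = x • ((1 : ZMod n), (0 : ZMod p)) + (0, y) := by simp
  rw [h2, map_add, h1, map_nsmul, nsmul_eq_mul, add_zero]

variable [NeZero n] [Fact p.Prime]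

lemma parity_one (h : AntipodalConnectionSet φ S N k μ) (hp : Odd p) : φ (1, 0) = 1 := by
  obtain ⟨⟨x, y⟩, hs⟩ := h.nonempty
  have h1 := h.parity _ hs
  rw [← ZMod.natCast_zmod_val x, parity_eq hp] at h1
  rcases zmod_two_cases (φ (1, 0)) with e | e
  · simp [e] at h1
  · exact e

lemma even_order (h : AntipodalConnectionSet φ S N k μ) (hp : Odd p) : Even n := by
  have := parity_eq (n := n) (φ := φ) hp n 0
  rw [h.parity_one hp] at this
  rw [← ZMod.natCast_eq_zero_iff_even]
  simpa [← Prod.zero_eq_mk] using this.symm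

lemma exists_odd_fst (h : AntipodalConnectionSet φ S N k μ) (hp : Odd p)
    {g : ZMod n × ZMod p} (hg : φ g = 1) : ∃ x : ℕ, Odd x ∧ g = ((x : ZMod n), g.2) := by
  refine ⟨g.1.val, ?_, by simp⟩
  have := parity_eq (n := n) (φ := φ) hp g.1.val g.2
  rw [h.parity_one hp, mul_one] at this
  rw [← ZMod.natCast_eq_one_iff_odd, ← this]
  simpa using hg

lemma card_eq_mul (h : AntipodalConnectionSet φ S N k μ) :
    n * p = 2 * (k * N.card) := by
  rw [← h.card_group, Fintype.card_prod, ZMod.card, ZMod.card]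

/-- If `n / 2` is odd, then so are `k`, `|N|` and `μ`. By parity every element of `ker φ` outside
`N` is twice an element of `S`, but there are too many of them. -/
lemma four_dvd (h : AntipodalConnectionSet φ S N k μ) (hp : Odd p) : 4 ∣ n := by
  obtain ⟨m, hm⟩ := h.even_order hp
  by_contra h4
  have hmodd : Odd m := by
    rw [← Nat.not_even_iff_odd]
    rintro ⟨l, hl⟩
    exact h4 ⟨l, by omega⟩
  have hcard : m * p = k * N.card := by
    have := h.card_eq_mul
    subst hm
    nlinarith
  have hodd : Odd (k * N.card) := hcard ▸ hmodd.mul hp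
  obtain ⟨hk, hN⟩ := Nat.odd_mul.mp hodd
  have hμ : ¬ Even μ := by
    rw [Nat.not_even_iff_odd]
    rw [h.valency_eq] at hk
    exact (Nat.odd_mul.mp hk).2
  have hsub : (univ.filter fun g => φ g = 0) ⊆ N ∪ S.image fun s => s + s := by
    intro g hg
    rw [mem_union, or_iff_not_imp_left]
    intro hgN
    by_contra hgS
    refine hμ (h.even_of_forall_add_self_ne (by simpa using hg) hgN fun s hs e => hgS ?_)
    exact mem_image.mpr ⟨s, hs, e⟩
  have hle := (card_le_card hsub).trans (card_union_le _ _)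
  have himg := card_image_le (s := S) (f := fun s => s + s)
  rw [h.card_even_part] at hle
  rw [h.card_eq] at himg
  have k2 := h.two_le
  have N2 := h.two_le_card
  have k3 : 3 ≤ k := by obtain ⟨a, ha⟩ := hk; omega
  have N3 : 3 ≤ N.card := by obtain ⟨a, ha⟩ := hN; omega
  nlinarith

/-- The multiplier theorem for a prescribed residue `u` modulo `n`: the prime is provided by
Dirichlet's theorem. -/
lemma multiplier_mod (h : AntipodalConnectionSet φ S N k μ) (hpn : p ∣ n) {u : ℕ}
    (hu : u.Coprime n) :
    (∀ g, φ g = 1 → (u • g ∈ S ↔ g ∈ S)) ∨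
      (N.card = 2 ∧ ∀ g, φ g = 1 → (u • g ∈ S ↔ g ∉ S)) := by
  obtain ⟨t, htk, ht, htu⟩ := Nat.forall_exists_prime_gt_and_modEq k (NeZero.ne n) hu
  have hk := h.two_le
  have htg : ∀ g : ZMod n × ZMod p, t • g = u • g := fun g => by
    have e1 : (t : ZMod n) = u := (ZMod.natCast_eq_natCast_iff _ _ _).mpr htu
    have e2 : (t : ZMod p) = u := (ZMod.natCast_eq_natCast_iff _ _ _).mpr (htu.of_dvd hpn)
    ext <;> simp [e1, e2]
  have hco : t.Coprime (Nat.card (ZMod n × ZMod p)) := by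
    have hn : t.Coprime n := by
      rw [Nat.Coprime, htu.gcd_eq]
      exact hu
    rw [Nat.card_prod, Nat.card_zmod, Nat.card_zmod]
    exact hn.mul_right (hn.coprime_dvd_right hpn)
  have hinj : Function.Injective fun g : ZMod n × ZMod p => t • g :=
    (nsmulCoprime hco.symm).injective
  have := h.multiplier ht (by omega)
    (fun hd => absurd (Nat.le_of_dvd (by omega) hd) (by omega)) hinj
  simpa only [htg] using this

/-- If `4 ∣ n`, multiplication by `1 + n / 2` translates every element outside `ker φ` by the same
nonzero element `(n / 2, 0)`. -/
lemma not_forall_multiple_mem (h : AntipodalConnectionSet φ S N k μ) (hp : Odd p) (hpn : p ∣ n)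
    {m : ℕ} (hm : n = 4 * m) : ¬ ∀ g, φ g = 1 → ((1 + 2 * m) • g ∈ S ↔ g ∈ S) := by
  intro hS
  have hn := NeZero.ne n
  refine h.not_forall_add_mem (z := (((2 * m : ℕ) : ZMod n), 0)) ?_ ?_ ?_
  · rw [parity_eq hp]
    push_cast
    rw [show (2 : ZMod 2) = 0 from rfl]
    simp
  · intro e
    have := congrArg Prod.fst e
    rw [Prod.fst_zero, ZMod.natCast_eq_zero_iff] at this
    have := Nat.le_of_dvd (by omega) this
    omega
  · intro s hs
    obtain ⟨x, ⟨y, hy⟩, hx⟩ := h.exists_odd_fst hp (h.parity s hs)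
    have h2m : ((2 * m : ℕ) : ZMod p) = 0 := by
      rw [ZMod.natCast_eq_zero_iff]
      have : p ∣ 2 * (2 * m) := by rw [hm] at hpn; convert hpn using 1; ring
      exact (Nat.Coprime.dvd_mul_left (Nat.coprime_two_right.mpr hp)).mp this
    have e : (1 + 2 * m) • s = s + (((2 * m : ℕ) : ZMod n), 0) := by
      rw [add_nsmul, one_nsmul, hx]
      congr 1
      ext
      · rw [Prod.smul_fst, nsmul_eq_mul, ← Nat.cast_mul]
        rw [ZMod.natCast_eq_natCast_iff, hm, hy,
          show 2 * m * (2 * y + 1) = 2 * m + 4 * m * y by ring]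
        simp [Nat.ModEq]
      · rw [Prod.smul_snd, nsmul_eq_mul, h2m, zero_mul]
    rw [← e]
    exact (hS s (h.parity s hs)).mpr hs

lemma coprime_one_add {a n : ℕ} (ha : ∀ q, q.Prime → q ∣ n → q ∣ a) : (1 + a).Coprime n := by
  refine Nat.coprime_of_dvd fun q hq h1 h2 => hq.one_lt.ne' ?_
  exact Nat.dvd_one.mp ((Nat.dvd_add_left (ha q hq h2)).mp h1)

theorem false_of_zmod_prod (h : AntipodalConnectionSet φ S N k μ) (hp : Odd p) (hpn : p ∣ n) :
    False := by
  obtain ⟨m, hm⟩ := h.four_dvd hp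
  have hn := NeZero.ne n
  have hprime : p.Prime := Fact.out
  have hp3 : 3 ≤ p := by
    obtain ⟨a, ha⟩ := hp
    have := hprime.two_le
    omega
  have hnot := h.not_forall_multiple_mem hp hpn hm
  have hu : (1 + 2 * m).Coprime n := coprime_one_add fun q hq hqn => by
    rw [hm, show 4 * m = 2 * (2 * m) by ring] at hqn
    rcases hq.dvd_mul.mp hqn with h2 | h2
    · exact h2.mul_right m
    · exact h2
  obtain h1 | ⟨hN2, -⟩ := h.multiplier_mod hpn hu
  · exact hnot h1
  -- now `|N| = 2`, so the element `g = (0, 1)` of odd order `p` lies outside `N`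
  have hg : φ ((0 : ZMod n), (1 : ZMod p)) = 0 := by
    simpa using parity_eq (n := n) (φ := φ) hp 0 1
  have : Fact (2 < p) := ⟨hp3⟩
  have hgN : ((0 : ZMod n), (1 : ZMod p)) ∉ N := by
    intro hg
    have hsub : ({(0, 0), (0, 1), (0, -1)} : Finset (ZMod n × ZMod p)) ⊆ N := by
      intro x hx
      simp only [mem_insert, mem_singleton] at hx
      rcases hx with rfl | rfl | rfl
      · exact h.zero_mem
      · exact hg
      · simpa using h.neg_mem' _ hg
    have := card_le_card hsub
    rw [hN2, card_eq_three.mpr ⟨_, _, _, ?_, ?_, ?_, rfl⟩] at this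
    · omega
    · simp
    · simp
    · simpa using (ZMod.neg_one_ne_one (n := p)).symm
  -- it is not twice an element with odd first coordinate
  have hμ : Even μ := by
    refine h.even_of_forall_add_self_ne hg hgN fun s hs e => ?_
    obtain ⟨x, ⟨y, hy⟩, hx⟩ := h.exists_odd_fst hp (h.parity s hs)
    have e1 := congrArg Prod.fst e
    rw [hx, Prod.fst_add, ← Nat.cast_add, ZMod.natCast_eq_zero_iff, hm] at e1
    obtain ⟨c, hc⟩ := e1
    rw [mul_assoc] at hc
    omega
  -- hence `16 ∣ n`, and `1 + n / 2` is the square of `1 + n / 4` modulo `n`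
  have h4m : 4 ∣ m := by
    obtain ⟨l, hl⟩ := hμ
    have hc := h.card_eq_mul
    rw [h.valency_eq, hN2, hm, hl] at hc
    have : 4 ∣ m * p := ⟨l, by nlinarith⟩
    have h2p : Nat.Coprime 4 p := by
      rw [show 4 = 2 ^ 2 by norm_num]
      exact (Nat.coprime_two_left.mpr hp).pow_left 2
    exact h2p.dvd_of_dvd_mul_right this
  obtain ⟨l, hl⟩ := h4m
  have hv : (1 + m).Coprime n := coprime_one_add fun q hq hqn => by
    rw [hm] at hqn
    rcases hq.dvd_mul.mp hqn with h2 | h2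
    · exact h2.trans ⟨l, hl⟩
    · exact h2
  have hsq : ∀ g : ZMod n × ZMod p, (1 + 2 * m) • g = (1 + m) • (1 + m) • g := fun g => by
    have hmod : (1 + m) * (1 + m) ≡ 1 + 2 * m [MOD n] := by
      rw [show (1 + m) * (1 + m) = 1 + 2 * m + n * l by rw [hm, hl]; ring]
      simp [Nat.ModEq]
    have e1 := (ZMod.natCast_eq_natCast_iff _ _ _).mpr hmod
    have e2 := (ZMod.natCast_eq_natCast_iff _ _ _).mpr (hmod.of_dvd hpn)
    rw [← mul_nsmul]
    ext
    · rw [Prod.smul_fst, Prod.smul_fst, nsmul_eq_mul, nsmul_eq_mul, e1]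
    · rw [Prod.smul_snd, Prod.smul_snd, nsmul_eq_mul, nsmul_eq_mul, e2]
  have hφv : ∀ g, φ ((1 + m) • g) = φ g := fun g => by
    have : ((1 + m : ℕ) : ZMod 2) = 1 := by
      rw [ZMod.natCast_eq_one_iff_odd]
      exact ⟨2 * l, by omega⟩
    rw [map_nsmul, nsmul_eq_mul, this, one_mul]
  refine hnot fun g hg => ?_
  rw [hsq]
  obtain h1 | ⟨-, h1⟩ := h.multiplier_mod hpn hv
  · rw [h1 _ ((hφv g).trans hg), h1 g hg]
  · rw [h1 _ ((hφv g).trans hg), h1 g hg, not_not]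

end AntipodalConnectionSet

/-- For an odd prime `p` dividing `n ≥ 1`, no Cayley graph over `ℤ_n ⊕ ℤ_p` (with an inverse closed
connection set `S` that does not contain the identity) is an antipodal bipartite distance-regular
graph of diameter `4`. -/
theorem mainTheorem3 (n p : ℕ) [NeZero n] [Fact p.Prime] (hp : Odd p) (hpn : p ∣ n)
    (S : Set (ZMod n × ZMod p)) (hS0 : (0 : ZMod n × ZMod p) ∉ S) (hSneg : ∀ s ∈ S, -s ∈ S) :
    ¬ ((SimpleGraph.addCayley S).IsDistanceRegular ∧
        (SimpleGraph.addCayley S).IsAntipodal ∧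
        (SimpleGraph.addCayley S).IsBipartite ∧
        (SimpleGraph.addCayley S).diam = 4) := by
  rintro ⟨hdr, hant, hb, hd⟩
  obtain ⟨φ, S', N, k, μ, h⟩ :=
    SimpleGraph.exists_antipodalConnectionSet hS0 hSneg hdr hant hb hd
  exact h.false_of_zmod_prod hp hpn
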